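/- Let $\mathbf{k}$ be a field and let $\hat B = \mathbf{k}[\![x,y,z]\!]/(xy,yz,xz)$, a complete local ring. For a finitely generated $\hat B$-module $M$, the Betti sequence $\beta(M) = (\beta_0,\beta_1,\beta_2,\dots)$ is the sequence of the numbers of generators (ranks) of the terms of a minimal free resolution of $M$ over $\hat B$. By the cone spanned by a set of rational sequences we mean the set of its finite linear combinations with coefficients in $\mathbf{Q}_{\ge 0}$. Then the following three cones in the space $\mathbf{Q}^{\mathbf{N}}$ of rational sequences $(\beta_0,\beta_1,\beta_2,\dots)$ are equal: (i) the cone spanned by the Betti sequences of all $\hat B$-modules of finite length; (ii) the cone spanned by the two sequences $(1,1,0,0,\dots)$ and $(1,3,6,12,24,\dots)$, where the first has all entries $0$ from index $2$ on, and the second has entries $1$ at index $0$ and $3\cdot 2^{i-1}$ at each index $i \ge 1$; (iii) the cone of all $(\beta_i)_{i\ge 0}$ with $\beta_2 \ge 0$, $2\beta_1 \ge \beta_2$, $3\beta_0 + \beta_2 = 3\beta_1$, and $\beta_i = 2\beta_{i-1}$ for all $i > 2$. -/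

import Mathlib

universe u

/-- The ideal `(xy, yz, xz)` of `k[[x, y, z]]`, with `x`, `y`, `z` the variables `X 0`, `X 1`,
`X 2`. -/
noncomputable def pointsIdeal (k : Type u) [Field k] : Ideal (MvPowerSeries (Fin 3) k) :=
  Ideal.span {MvPowerSeries.X 0 * MvPowerSeries.X 1, MvPowerSeries.X 1 * MvPowerSeries.X 2,
    MvPowerSeries.X 0 * MvPowerSeries.X 2}

/-- The complete local ring `k[[x, y, z]] / (xy, yz, xz)`. -/
abbrev BHat (k : Type u) [Field k] : Type u :=
  MvPowerSeries (Fin 3) k ⧸ pointsIdeal k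

theorem pointsIdeal_ne_top (k : Type u) [Field k] : pointsIdeal k ≠ ⊤ := by
  intro h
  have hle : pointsIdeal k ≤ RingHom.ker (MvPowerSeries.constantCoeff (σ := Fin 3) (R := k)) := by
    refine Ideal.span_le.2 ?_
    rintro a (rfl | rfl | rfl) <;> simp [RingHom.mem_ker]
  have h1 : (1 : MvPowerSeries (Fin 3) k) ∈ pointsIdeal k := h ▸ Submodule.mem_top
  have h2 := hle h1
  simp [RingHom.mem_ker] at h2

instance BHat.instNontrivial (k : Type u) [Field k] : Nontrivial (BHat k) :=
  Ideal.Quotient.nontrivial_iff.2 (pointsIdeal_ne_top k)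

instance BHat.instIsLocalRing (k : Type u) [Field k] : IsLocalRing (BHat k) :=
  IsLocalRing.of_surjective' (Ideal.Quotient.mk (pointsIdeal k)) Ideal.Quotient.mk_surjective

/-- A minimal free resolution
`⋯ → R^(b 2) → R^(b 1) → R^(b 0) → M → 0` of a module `M` over a local ring `R`, with terms of
finite rank: an exact sequence in which the image of every differential
`d i : R^(b (i+1)) → R^(b i)` lies in `𝔪 R^(b i)`, where `𝔪` is the maximal ideal of `R`. -/
structure MinimalFreeResolution (R : Type u) [CommRing R] [IsLocalRing R]
    (M : Type u) [AddCommGroup M] [Module R M] (b : ℕ → ℕ) where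
  /-- the augmentation -/
  aug : (Fin (b 0) → R) →ₗ[R] M
  /-- the differentials -/
  d : ∀ i : ℕ, (Fin (b (i + 1)) → R) →ₗ[R] (Fin (b i) → R)
  aug_surjective : Function.Surjective aug
  exact_aug : Function.Exact (d 0) aug
  exact_d : ∀ i : ℕ, Function.Exact (d (i + 1)) (d i)
  minimal : ∀ i : ℕ, LinearMap.range (d i) ≤
    IsLocalRing.maximalIdeal R • (⊤ : Submodule R (Fin (b i) → R))

/-- `b` is the Betti sequence of `M`: the sequence of the numbers of generators of the terms of a
minimal free resolution of `M`. -/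
def IsBettiSequence (R : Type u) [CommRing R] [IsLocalRing R]
    (M : Type u) [AddCommGroup M] [Module R M] (b : ℕ → ℕ) : Prop :=
  Nonempty (MinimalFreeResolution R M b)

/-- The set of Betti sequences, as vectors in `ℚ^ℕ`, of all `R`-modules of finite length. -/
def finiteLengthBettiSequences (R : Type u) [CommRing R] [IsLocalRing R] : Set (ℕ → ℚ) :=
  {v | ∃ (M : Type u) (_ : AddCommGroup M) (_ : Module R M) (b : ℕ → ℕ),
    IsFiniteLength R M ∧ IsBettiSequence R M b ∧ v = fun i => (b i : ℚ)}

/-- The sequence `(1, 1, 0, 0, …)`. -/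
def rayFree : ℕ → ℚ := fun i => if i ≤ 1 then 1 else 0

/-- The sequence `(1, 3, 6, 12, 24, …)`: its entries are `1` and then `3 * 2 ^ (i - 1)` for
`i ≥ 1`. -/
def rayResidue : ℕ → ℚ
  | 0 => 1
  | i + 1 => 3 * 2 ^ i

/-- The cone in `ℚ^ℕ` cut out by `β₂ ≥ 0`, `2 β₁ ≥ β₂`, `3 β₀ + β₂ = 3 β₁` and `βᵢ = 2 βᵢ₋₁` for
`i > 2`. -/
def inequalityCone : Set (ℕ → ℚ) :=
  {β | 0 ≤ β 2 ∧ β 2 ≤ 2 * β 1 ∧ 3 * β 0 + β 2 = 3 * β 1 ∧ ∀ i : ℕ, 2 < i → β i = 2 * β (i - 1)}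

/-! ### Lengths modulo an ideal and modulo a nonzerodivisor. -/

section LengthModSMul

open scoped Pointwise

variable {R : Type*} [CommRing R]

/-! Let `t = x + y + z`, a nonzerodivisor with `R/t` of length 3, and write `ℓ(N)` for the length of
`N/tN`. Let `Ω₁, Ω₂, …` be the syzygies of a finite length module. Since `Ω₁` has finite colength in
`R^b₀`, `ℓ(Ω₁) = 3b₀`; additivity gives `ℓ(Ωᵢ₊₁) + ℓ(Ωᵢ) = 3bᵢ`. From `Ω₂` on, `𝔪Ω = tΩ`
(`maximalIdeal_smul_ker_le`), so `ℓ(Ωᵢ) = bᵢ`, while for `Ω₁` only `b₁ ≤ ℓ(Ω₁)`. These give all the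
relations of the inequality cone (`betti_relations`). Conversely, a point of that cone is an
explicit nonnegative combination of the two rays, which are the Betti sequences of `R/t`
(`regularResolution`) and of the residue field (`residueResolution`). -/

theorem Submodule.mem_ideal_smul_top_pi_iff {n : ℕ} (I : Ideal R) (v : Fin n → R) :
    v ∈ I • (⊤ : Submodule R (Fin n → R)) ↔ ∀ j, v j ∈ I := by
  constructor
  · intro hv j
    induction hv using Submodule.smul_induction_on' with
    | smul r hr w _ => exact I.mul_mem_right _ hr
    | add a _ b _ ha hb => exact I.add_mem ha hb
  · intro h
    rw [pi_eq_sum_univ' v]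
    exact Submodule.sum_mem _ fun j _ => Submodule.smul_mem_smul (h j) Submodule.mem_top

theorem Module.length_pi_quotient_smul_top (n : ℕ) (I : Ideal R) :
    Module.length R ((Fin n → R) ⧸ (I • (⊤ : Submodule R (Fin n → R)))) =
      n * Module.length R (R ⧸ I) := by
  have e := LinearMap.quotKerEquivOfSurjective (I.mkQ.compLeft (Fin n))
    (fun v => ⟨fun j => (I.mkQ_surjective (v j)).choose,
      funext fun j => (I.mkQ_surjective (v j)).choose_spec⟩)
  have hk : LinearMap.ker (I.mkQ.compLeft (Fin n)) = I • (⊤ : Submodule R (Fin n → R)) := by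
    ext v
    rw [Submodule.mem_ideal_smul_top_pi_iff, LinearMap.mem_ker, funext_iff]
    exact forall_congr' fun j => Ideal.Quotient.eq_zero_iff_mem
  rw [← (Submodule.quotEquivOfEq _ _ hk).length_eq, e.length_eq, Module.length_pi]
  simp

variable {M N P : Type*} [AddCommGroup M] [Module R M] [AddCommGroup N] [Module R N]
  [AddCommGroup P] [Module R P]

/-- `N/IN` is `M/(IM + ker f)`, and the kernel adds nothing. For `I = 𝔪` this counts generators from
a minimal presentation. -/
theorem Module.length_quotient_smul_top_of_ker_le (I : Ideal R) (f : M →ₗ[R] N)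
    (hf : Function.Surjective f) (hk : LinearMap.ker f ≤ I • (⊤ : Submodule R M)) :
    Module.length R (N ⧸ (I • (⊤ : Submodule R N))) =
      Module.length R (M ⧸ (I • (⊤ : Submodule R M))) := by
  set g := (I • (⊤ : Submodule R N)).mkQ ∘ₗ f
  have hg : Function.Surjective g := (Submodule.mkQ_surjective _).comp hf
  have hker : LinearMap.ker g = I • (⊤ : Submodule R M) := by
    rw [LinearMap.ker_comp, Submodule.ker_mkQ, ← LinearMap.range_eq_top.2 hf,
      LinearMap.range_eq_map, ← Submodule.map_smul'', Submodule.comap_map_eq, sup_eq_left]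
    exact hk
  rw [← (Submodule.quotEquivOfEq _ _ hker).length_eq]
  exact (g.quotKerEquivOfSurjective hg).length_eq.symm

theorem Module.length_quotient_smul_top_le {I : Ideal R} {t : R} (ht : t ∈ I) :
    Module.length R (M ⧸ (I • (⊤ : Submodule R M))) ≤ Module.length R (QuotSMulTop t M) := by
  have h : t • (⊤ : Submodule R M) ≤ I • ⊤ := by
    rw [← Submodule.ideal_span_singleton_smul]
    exact Submodule.smul_mono_left ((Ideal.span_singleton_le_iff_mem _).2 ht)
  exact Module.length_le_of_surjective (Submodule.factor h) (Submodule.factor_surjective h)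

theorem Module.length_quotSMulTop_eq {I : Ideal R} {t : R} (ht : t ∈ I)
    (h : I • (⊤ : Submodule R M) ≤ t • ⊤) :
    Module.length R (QuotSMulTop t M) = Module.length R (M ⧸ (I • (⊤ : Submodule R M))) :=
  le_antisymm
    (Module.length_le_of_surjective (Submodule.factor h) (Submodule.factor_surjective h))
    (Module.length_quotient_smul_top_le ht)

theorem Module.length_quotSMulTop_pi (n : ℕ) (t : R) :
    Module.length R (QuotSMulTop t (Fin n → R)) = n * Module.length R (R ⧸ Ideal.span {t}) := by
  rw [← Module.length_pi_quotient_smul_top]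
  exact (Submodule.quotEquivOfEq _ _ (Submodule.ideal_span_singleton_smul _ _).symm).length_eq

/-- Regularity of `t` on the quotient kills the Tor term, so reduction modulo `t` stays exact on the
left. -/
theorem Module.length_quotSMulTop_eq_add {t : R} (f : M →ₗ[R] N) (g : N →ₗ[R] P)
    (hf : Function.Injective f) (hg : Function.Surjective g) (hfg : Function.Exact f g)
    (ht : IsSMulRegular P t) :
    Module.length R (QuotSMulTop t N) =
      Module.length R (QuotSMulTop t M) + Module.length R (QuotSMulTop t P) := by
  refine Module.length_eq_add_of_exact (QuotSMulTop.map t f) (QuotSMulTop.map t g) ?_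
    (QuotSMulTop.map_surjective t hg) (QuotSMulTop.map_exact t hfg hg)
  rw [injective_iff_map_eq_zero]
  intro a ha
  obtain ⟨a, rfl⟩ := Submodule.Quotient.mk_surjective _ a
  rw [QuotSMulTop.map_apply_mk, Submodule.Quotient.mk_eq_zero,
    Submodule.mem_smul_pointwise_iff_exists] at ha
  obtain ⟨n, -, hn⟩ := ha
  have hgn : g n = 0 := by
    refine ht.right_eq_zero_of_smul ?_
    rw [← map_smul, hn, hfg.apply_apply_eq_zero]
  obtain ⟨m, rfl⟩ := (hfg n).1 hgn
  rw [← map_smul] at hn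
  rw [← hf hn, Submodule.Quotient.mk_eq_zero]
  exact Submodule.smul_mem_pointwise_smul _ _ _ Submodule.mem_top

/-- A submodule of finite colength has the same length modulo a nonzerodivisor as the whole
module. -/
theorem Module.length_quotSMulTop_of_finite_colength {t : R} (ht : IsSMulRegular M t)
    (K : Submodule R M) (hK : IsFiniteLength R (M ⧸ K)) :
    Module.length R (QuotSMulTop t K) = Module.length R (QuotSMulTop t M) := by
  have hle : t • K ≤ K := by
    rintro _ ⟨a, ha, rfl⟩
    exact K.smul_mem t ha
  have hle' : t • K ≤ t • (⊤ : Submodule R M) := smul_mono_right t le_top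
  have hKle : t • (⊤ : Submodule R K) ≤ (t • K).comap K.subtype := by
    rintro _ ⟨a, -, rfl⟩
    exact ⟨a, a.2, rfl⟩
  -- The length of `M/tK` is computed along `tK ⊆ K ⊆ M` and along `tK ⊆ tM ⊆ M`, where `tM/tK ≅
  -- M/K` by regularity; the finite length of `M/K` then cancels.
  have h1 : Module.length R (M ⧸ (t • K)) =
      Module.length R (QuotSMulTop t K) + Module.length R (M ⧸ K) := by
    refine Module.length_eq_add_of_exact (Submodule.mapQ _ (t • K) K.subtype hKle)
      (Submodule.factor hle) ?_ (Submodule.factor_surjective hle) ?_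
    · rw [injective_iff_map_eq_zero]
      intro a ha
      obtain ⟨a, rfl⟩ := Submodule.Quotient.mk_surjective _ a
      rw [Submodule.mapQ_apply, Submodule.Quotient.mk_eq_zero] at ha
      obtain ⟨b, hb, hab⟩ := ha
      rw [Submodule.Quotient.mk_eq_zero]
      exact ⟨⟨b, hb⟩, trivial, Subtype.ext hab⟩
    · intro y
      obtain ⟨y, rfl⟩ := Submodule.Quotient.mk_surjective _ y
      constructor
      · intro hy
        have hy' : y ∈ K := (Submodule.Quotient.mk_eq_zero K).1 hy
        exact ⟨Submodule.Quotient.mk ⟨y, hy'⟩, rfl⟩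
      · rintro ⟨z, hz⟩
        obtain ⟨z, rfl⟩ := Submodule.Quotient.mk_surjective _ z
        rw [← hz]
        exact (Submodule.Quotient.mk_eq_zero K).2 z.2
  have hKle' : K ≤ (t • K).comap (LinearMap.lsmul R M t) := fun a ha => ⟨a, ha, rfl⟩
  have h2 : Module.length R (M ⧸ (t • K)) =
      Module.length R (M ⧸ K) + Module.length R (QuotSMulTop t M) := by
    refine Module.length_eq_add_of_exact (Submodule.mapQ K (t • K) (LinearMap.lsmul R M t) hKle')
      (Submodule.factor hle') ?_ (Submodule.factor_surjective hle') ?_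
    · rw [injective_iff_map_eq_zero]
      intro a ha
      obtain ⟨a, rfl⟩ := Submodule.Quotient.mk_surjective _ a
      rw [Submodule.mapQ_apply, Submodule.Quotient.mk_eq_zero] at ha
      obtain ⟨b, hb, hab⟩ := ha
      rw [Submodule.Quotient.mk_eq_zero, ← ht hab]
      exact hb
    · intro y
      obtain ⟨y, rfl⟩ := Submodule.Quotient.mk_surjective _ y
      constructor
      · intro hy
        obtain ⟨z, -, rfl⟩ := (Submodule.Quotient.mk_eq_zero (t • (⊤ : Submodule R M))).1 hy
        exact ⟨Submodule.Quotient.mk z, rfl⟩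
      · rintro ⟨z, hz⟩
        obtain ⟨z, rfl⟩ := Submodule.Quotient.mk_surjective _ z
        rw [← hz]
        exact (Submodule.Quotient.mk_eq_zero (t • (⊤ : Submodule R M))).2 ⟨z, trivial, rfl⟩
  rw [h1, add_comm] at h2
  exact ENat.add_right_injective_of_ne_top (Module.length_ne_top_iff.2 hK) h2

end LengthModSMul

/-! ### Local rings of three coordinate axes and their syzygies. -/

section CoordinateAxes

open scoped Pointwise

theorem IsLocalRing.length_quotient_maximalIdeal (R : Type*) [CommRing R] [IsLocalRing R] :
    Module.length R (R ⧸ IsLocalRing.maximalIdeal R) = 1 := by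
  rw [Module.length_eq_one_iff, isSimpleModule_iff_isCoatom]
  exact Ideal.isMaximal_def.1 inferInstance

/-- A local ring `R` with elements `x 0`, `x 1`, `x 2` that behave like the coordinate functions on
the union of the three coordinate axes. -/
structure IsAxesSystem {R : Type*} [CommRing R] [IsLocalRing R] (x : Fin 3 → R) : Prop where
  mul_eq_zero : ∀ i j, i ≠ j → x i * x j = 0
  mul_mul_eq_zero : ∀ i w, x i * (x i * w) = 0 → x i * w = 0
  exists_of_mul_eq_zero : ∀ i w, x i * w = 0 → ∃ a b, w = x (i + 1) * a + x (i + 2) * b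
  mem_maximalIdeal_iff : ∀ w, w ∈ IsLocalRing.maximalIdeal R ↔ ∃ a : Fin 3 → R, w = ∑ i, x i * a i

namespace IsAxesSystem

variable {R : Type*} [CommRing R] [IsLocalRing R] {x : Fin 3 → R} (hx : IsAxesSystem x)
include hx

theorem mem_maximalIdeal (i : Fin 3) : x i ∈ IsLocalRing.maximalIdeal R :=
  (hx.mem_maximalIdeal_iff _).2 ⟨Pi.single i 1, by simp [Pi.single_apply]⟩

theorem sum_mem_maximalIdeal : ∑ i, x i ∈ IsLocalRing.maximalIdeal R :=
  Ideal.sum_mem _ fun i _ => hx.mem_maximalIdeal i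

theorem mul_sum (i : Fin 3) (a : Fin 3 → R) : x i * ∑ j, x j * a j = x i * (x i * a i) := by
  rw [Finset.mul_sum, Finset.sum_eq_single i]
  · intro j _ hj
    rw [← mul_assoc, hx.mul_eq_zero i j hj.symm, zero_mul]
  · simp

theorem sum_mul (i : Fin 3) (a : R) : (∑ j, x j) * (x i * a) = x i * (x i * a) := by
  have h := hx.mul_sum i 1
  simp only [Pi.one_apply, mul_one] at h
  rw [← mul_assoc, mul_comm _ (x i), h, mul_assoc]

/-- The ideals generated by the coordinates form a direct sum. -/
theorem mul_eq_zero_of_sum (a : Fin 3 → R) (h : ∑ j, x j * a j = 0) (i : Fin 3) :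
    x i * a i = 0 := by
  apply hx.mul_mul_eq_zero
  rw [← hx.mul_sum, h, mul_zero]

theorem mem_maximalIdeal_of_mul_eq_zero {i : Fin 3} {w : R} (h : x i * w = 0) :
    w ∈ IsLocalRing.maximalIdeal R := by
  obtain ⟨a, b, rfl⟩ := hx.exists_of_mul_eq_zero i w h
  exact Ideal.add_mem _ (Ideal.mul_mem_right _ _ (hx.mem_maximalIdeal _))
    (Ideal.mul_mem_right _ _ (hx.mem_maximalIdeal _))

theorem eq_zero_of_forall_mul_eq_zero (w : R) (h : ∀ i, x i * w = 0) : w = 0 := by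
  obtain ⟨a, rfl⟩ := (hx.mem_maximalIdeal_iff w).1 (hx.mem_maximalIdeal_of_mul_eq_zero (h 0))
  refine Finset.sum_eq_zero fun i _ => hx.mul_mul_eq_zero i _ ?_
  rw [← hx.mul_sum, h]

/-- On the ideal of one axis coordinate, `t` acts as that coordinate, which is injective there; and
no nonzero element is killed by all three coordinates. -/
theorem isSMulRegular_sum : IsSMulRegular R (∑ i, x i) := by
  refine IsSMulRegular.of_right_eq_zero_of_smul fun w hw => ?_
  refine hx.eq_zero_of_forall_mul_eq_zero w fun i => hx.mul_mul_eq_zero i _ ?_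
  rw [← hx.sum_mul, mul_left_comm, ← smul_eq_mul (∑ i, x i), hw, mul_zero]

theorem isSMulRegular_sum_pi (n : ℕ) : IsSMulRegular (Fin n → R) (∑ i, x i) := by
  intro v w h
  funext j
  exact hx.isSMulRegular_sum (congrFun h j)

theorem exists_eq_sum_smul {n : ℕ} {v : Fin n → R}
    (hv : v ∈ IsLocalRing.maximalIdeal R • (⊤ : Submodule R (Fin n → R))) :
    ∃ a : Fin 3 → Fin n → R, v = ∑ i, x i • a i := by
  rw [Submodule.mem_ideal_smul_top_pi_iff] at hv
  choose a ha using fun j => (hx.mem_maximalIdeal_iff _).1 (hv j)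
  refine ⟨fun i j => a j i, funext fun j => ?_⟩
  rw [ha j]
  simp

/-- On the kernel of a map between free modules that lies in `𝔪 Rⁿ`, the ideal `𝔪` acts through
the single element `x 0 + x 1 + x 2`. -/
theorem maximalIdeal_smul_ker_le {n m : ℕ} (f : (Fin n → R) →ₗ[R] (Fin m → R))
    (hf : LinearMap.ker f ≤ IsLocalRing.maximalIdeal R • (⊤ : Submodule R (Fin n → R))) :
    IsLocalRing.maximalIdeal R • (⊤ : Submodule R (LinearMap.ker f)) ≤
      (∑ i, x i) • (⊤ : Submodule R (LinearMap.ker f)) := by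
  rw [Submodule.smul_le]
  rintro r hr ⟨v, hv⟩ -
  obtain ⟨c, rfl⟩ := (hx.mem_maximalIdeal_iff r).1 hr
  obtain ⟨a, rfl⟩ := hx.exists_eq_sum_smul (hf hv)
  -- The ideals `(x i)` are independent, so each axis component of a kernel element is itself in the
  -- kernel.
  have key : ∀ i, x i • a i ∈ LinearMap.ker f := by
    intro i
    rw [LinearMap.mem_ker, map_sum] at hv
    rw [LinearMap.mem_ker]
    funext j
    have := hx.mul_eq_zero_of_sum (fun i => f (a i) j) (by simpa using congrFun hv j) i
    simpa using this
  -- On the component along axis `i`, `∑ x j c j` acts as `x i c i`, hence as `t c i`.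
  refine ⟨∑ i, c i • ⟨x i • a i, key i⟩, trivial, Subtype.ext (funext fun j => ?_)⟩
  simp only [DistribSMul.toLinearMap_apply, SetLike.val_smul, AddSubmonoidClass.coe_finsetSum,
    Pi.smul_apply, Finset.sum_apply, smul_eq_mul, Finset.mul_sum]
  refine Finset.sum_congr rfl fun i _ => ?_
  rw [mul_left_comm, hx.sum_mul, mul_comm (∑ i, x i * c i), mul_right_comm, hx.mul_sum]
  ring

theorem maximalIdeal_smul_self_le :
    IsLocalRing.maximalIdeal R • (⊤ : Submodule R (IsLocalRing.maximalIdeal R)) ≤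
      (∑ i, x i) • (⊤ : Submodule R (IsLocalRing.maximalIdeal R)) := by
  rw [Submodule.smul_le]
  rintro r hr ⟨w, hw⟩ -
  obtain ⟨c, rfl⟩ := (hx.mem_maximalIdeal_iff r).1 hr
  obtain ⟨a, rfl⟩ := (hx.mem_maximalIdeal_iff w).1 hw
  refine ⟨⟨∑ i, x i * (a i * c i), (hx.mem_maximalIdeal_iff _).2 ⟨_, rfl⟩⟩, trivial,
    Subtype.ext ?_⟩
  simp only [DistribSMul.toLinearMap_apply, SetLike.val_smul, smul_eq_mul, Finset.mul_sum]
  refine Finset.sum_congr rfl fun i _ => ?_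
  rw [hx.sum_mul, mul_comm (∑ i, x i * c i), mul_right_comm, hx.mul_sum]
  ring

/-- As `𝔪` has finite colength, `R/t` and `𝔪/t𝔪` have equal length; `t𝔪 = 𝔪²`, and `𝔪` has three
minimal generators. -/
theorem length_quotient_sum : Module.length R (R ⧸ Ideal.span {∑ i, x i}) = 3 := by
  set t := ∑ i, x i with ht
  set g : (Fin 3 → R) →ₗ[R] IsLocalRing.maximalIdeal R :=
    Fintype.linearCombination R fun i => ⟨x i, hx.mem_maximalIdeal i⟩ with hg
  have hgv : ∀ v, (g v : R) = ∑ i, x i * v i := by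
    intro v
    simp [hg, Fintype.linearCombination_apply, mul_comm]
  have hsurj : Function.Surjective g := by
    rintro ⟨w, hw⟩
    obtain ⟨a, rfl⟩ := (hx.mem_maximalIdeal_iff w).1 hw
    exact ⟨a, Subtype.ext (hgv a)⟩
  have hker : LinearMap.ker g ≤ IsLocalRing.maximalIdeal R • (⊤ : Submodule R (Fin 3 → R)) := by
    intro v hv
    rw [Submodule.mem_ideal_smul_top_pi_iff]
    refine fun j => hx.mem_maximalIdeal_of_mul_eq_zero (hx.mul_eq_zero_of_sum v ?_ j)
    rw [← hgv, LinearMap.mem_ker.1 hv, Submodule.coe_zero]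
  have h1 := Module.length_quotient_smul_top_of_ker_le _ g hsurj hker
  rw [Module.length_pi_quotient_smul_top, IsLocalRing.length_quotient_maximalIdeal,
    ← Module.length_quotSMulTop_eq hx.sum_mem_maximalIdeal hx.maximalIdeal_smul_self_le,
    Module.length_quotSMulTop_of_finite_colength hx.isSMulRegular_sum _
      (Module.length_ne_top_iff.1 (by rw [IsLocalRing.length_quotient_maximalIdeal]; simp))] at h1
  have h2 : t • (⊤ : Ideal R) = Ideal.span {t} := by
    rw [← Submodule.ideal_span_singleton_smul, smul_eq_mul, Ideal.mul_top]
  rw [← (Submodule.quotEquivOfEq _ _ h2).length_eq]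
  simpa using h1

end IsAxesSystem

/-! ### Numerical relations between Betti numbers. -/

namespace MinimalFreeResolution

variable {R : Type u} [CommRing R] [IsLocalRing R] {x : Fin 3 → R} (hx : IsAxesSystem x)
  {M : Type u} [AddCommGroup M] [Module R M] {b : ℕ → ℕ} (F : MinimalFreeResolution R M b)

theorem ker_d (i : ℕ) : LinearMap.ker (F.d i) = LinearMap.range (F.d (i + 1)) :=
  (F.exact_d i).linearMap_ker_eq

theorem length_range_d_quotient (i : ℕ) :
    Module.length R (LinearMap.range (F.d i) ⧸
      (IsLocalRing.maximalIdeal R • (⊤ : Submodule R (LinearMap.range (F.d i))))) = b (i + 1) := by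
  rw [Module.length_quotient_smul_top_of_ker_le _ (F.d i).rangeRestrict
    (F.d i).surjective_rangeRestrict, Module.length_pi_quotient_smul_top, IsLocalRing.length_quotient_maximalIdeal,
    mul_one]
  rw [LinearMap.ker_rangeRestrict, F.ker_d]
  exact F.minimal (i + 1)

include hx

/-- The cokernel of `d 0` is `M`, so the first syzygy has finite colength in a free module. -/
theorem length_range_d_zero (hM : IsFiniteLength R M) :
    Module.length R (QuotSMulTop (∑ i, x i) (LinearMap.range (F.d 0))) = 3 * b 0 := by
  rw [Module.length_quotSMulTop_of_finite_colength (hx.isSMulRegular_sum_pi _),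
    Module.length_quotSMulTop_pi, hx.length_quotient_sum, mul_comm]
  rw [← F.exact_aug.linearMap_ker_eq]
  exact Module.length_ne_top_iff.1 ((F.aug.quotKerEquivOfSurjective F.aug_surjective).length_eq ▸
    Module.length_ne_top_iff.2 hM)

theorem length_range_d_succ_add (i : ℕ) :
    Module.length R (QuotSMulTop (∑ i, x i) (LinearMap.range (F.d (i + 1)))) +
      Module.length R (QuotSMulTop (∑ i, x i) (LinearMap.range (F.d i))) = 3 * b (i + 1) := by
  have h := Module.length_quotSMulTop_eq_add (t := ∑ i, x i)
    (LinearMap.ker (F.d i)).subtype (F.d i).rangeRestrict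
    (Submodule.injective_subtype _) (F.d i).surjective_rangeRestrict
    (by
      rw [LinearMap.exact_iff, LinearMap.ker_rangeRestrict, Submodule.range_subtype])
    ((hx.isSMulRegular_sum_pi _).submodule _ _)
  rw [Module.length_quotSMulTop_pi, hx.length_quotient_sum, F.ker_d, mul_comm] at h
  exact h.symm

/-- Needed for the first syzygy, where equality can fail: for `M = R/t` it reads `1 ≤ 3`. -/
theorem le_length_range_d (i : ℕ) :
    (b (i + 1) : ℕ∞) ≤ Module.length R (QuotSMulTop (∑ i, x i) (LinearMap.range (F.d i))) := by
  rw [← F.length_range_d_quotient i]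
  exact Module.length_quotient_smul_top_le hx.sum_mem_maximalIdeal

theorem length_range_d_succ (i : ℕ) :
    Module.length R (QuotSMulTop (∑ i, x i) (LinearMap.range (F.d (i + 1)))) = b (i + 2) := by
  rw [← F.length_range_d_quotient (i + 1)]
  refine Module.length_quotSMulTop_eq hx.sum_mem_maximalIdeal ?_
  rw [← F.ker_d]
  refine hx.maximalIdeal_smul_ker_le _ ?_
  rw [F.ker_d]
  exact F.minimal (i + 1)

theorem betti_relations (F : MinimalFreeResolution R M b) (hM : IsFiniteLength R M) :
    b 2 ≤ 2 * b 1 ∧ 3 * b 0 + b 2 = 3 * b 1 ∧ ∀ i, b (i + 3) = 2 * b (i + 2) := by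
  have h0 := F.length_range_d_zero hx hM
  have h1 := F.length_range_d_succ_add hx 0
  have h2 := F.le_length_range_d hx 0
  rw [F.length_range_d_succ hx, h0] at h1
  rw [h0] at h2
  norm_cast at h1 h2
  refine ⟨by lia, by lia, fun i => ?_⟩
  have h3 := F.length_range_d_succ_add hx (i + 1)
  rw [F.length_range_d_succ hx, F.length_range_d_succ hx] at h3
  norm_cast at h3
  rw [show i + 1 + 2 = i + 3 from rfl, show i + 1 + 1 = i + 2 from rfl] at h3
  lia

end MinimalFreeResolution

end CoordinateAxes

/-! ### Minimal resolution of the residue field. -/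

section ResidueResolution

/-- The numbers `3, 6, 12, 24, …`. -/
def threeMulTwoPow : ℕ → ℕ
  | 0 => 3
  -- The factor 2 on the right matches `finProdFinEquiv : Fin n × Fin 2 ≃ Fin (n * 2)`
  -- definitionally.
  | i + 1 => threeMulTwoPow i * 2

/-- The numbers `1, 3, 6, 12, 24, …`. -/
def residueBetti : ℕ → ℕ
  | 0 => 1
  | i + 1 => threeMulTwoPow i

theorem threeMulTwoPow_eq (i : ℕ) : threeMulTwoPow i = 3 * 2 ^ i := by
  induction i with
  | zero => rfl
  | succ i ih => rw [threeMulTwoPow, ih, pow_succ, mul_assoc]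

/-- The annihilator of the coordinate `c J` is generated by the other two coordinates
`branchColor c (J, 0)` and `branchColor c (J, 1)`. -/
def branchColor {n : ℕ} (c : Fin n → Fin 3) (p : Fin (n * 2)) : Fin 3 :=
  c (finProdFinEquiv.symm p).1 + 1 + (finProdFinEquiv.symm p).2.castSucc

theorem branchColor_zero {n : ℕ} (c : Fin n → Fin 3) (J : Fin n) :
    branchColor c (finProdFinEquiv (J, 0)) = c J + 1 := by
  simp [branchColor]

theorem branchColor_one {n : ℕ} (c : Fin n → Fin 3) (J : Fin n) :
    branchColor c (finProdFinEquiv (J, 1)) = c J + 2 := by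
  simp [branchColor, add_assoc]

/-- The coordinate by which each generator is multiplied in the resolution of the residue field. -/
def residueColor : ∀ i : ℕ, Fin (threeMulTwoPow i) → Fin 3
  | 0 => id
  | i + 1 => branchColor (residueColor i)

variable {R : Type u} [CommRing R]

/-- The row `(x 0, x 1, x 2)`. -/
def coordRow (x : Fin 3 → R) : (Fin 3 → R) →ₗ[R] (Fin 1 → R) :=
  LinearMap.pi fun _ => ∑ j, x j • LinearMap.proj j

theorem coordRow_apply (x : Fin 3 → R) (v : Fin 3 → R) (j : Fin 1) :
    coordRow x v j = ∑ i, x i * v i := by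
  simp [coordRow]

/-- The direct sum of the rows `(x (c J + 1), x (c J + 2))`. -/
def branchMap (x : Fin 3 → R) {n : ℕ} (c : Fin n → Fin 3) :
    (Fin (n * 2) → R) →ₗ[R] (Fin n → R) :=
  LinearMap.pi fun J => x (c J + 1) • LinearMap.proj (finProdFinEquiv (J, 0)) +
    x (c J + 2) • LinearMap.proj (finProdFinEquiv (J, 1))

theorem branchMap_apply (x : Fin 3 → R) {n : ℕ} (c : Fin n → Fin 3) (v : Fin (n * 2) → R)
    (J : Fin n) :
    branchMap x c v J = x (c J + 1) * v (finProdFinEquiv (J, 0)) +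
      x (c J + 2) * v (finProdFinEquiv (J, 1)) := rfl

/-- The differentials of the resolution of the residue field. -/
def residueD (x : Fin 3 → R) : ∀ i : ℕ,
    (Fin (residueBetti (i + 1)) → R) →ₗ[R] (Fin (residueBetti i) → R)
  | 0 => coordRow x
  | i + 1 => branchMap x (residueColor i)

variable [IsLocalRing R] {x : Fin 3 → R} (hx : IsAxesSystem x)

namespace IsAxesSystem
include hx

theorem mul_eq_zero_of_add {i j : Fin 3} (hij : i ≠ j) {a b : R} (h : x i * a + x j * b = 0) :
    x i * a = 0 := by
  refine hx.mul_mul_eq_zero i a ?_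
  have h' := congrArg (x i * ·) h
  simpa [mul_add, ← mul_assoc, hx.mul_eq_zero i j hij] using h'

theorem coordRow_eq_zero_iff (v : Fin 3 → R) : coordRow x v = 0 ↔ ∀ i, x i * v i = 0 := by
  constructor
  · intro h
    exact hx.mul_eq_zero_of_sum v (by rw [← coordRow_apply x v 0, h]; rfl)
  · intro h
    funext j
    rw [coordRow_apply]
    exact Finset.sum_eq_zero fun i _ => h i

/-- Independence of the axis ideals decouples the two terms in each row, so the kernel is a product
of annihilators of coordinates, the shape of the range in `mem_range_branchMap_iff`. -/
theorem branchMap_eq_zero_iff {n : ℕ} (c : Fin n → Fin 3) (v : Fin (n * 2) → R) :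
    branchMap x c v = 0 ↔ ∀ p, x (branchColor c p) * v p = 0 := by
  constructor
  · intro h p
    obtain ⟨⟨J, s⟩, rfl⟩ := finProdFinEquiv.surjective p
    have hJ := congrFun h J
    rw [branchMap_apply, Pi.zero_apply] at hJ
    obtain rfl | rfl : s = 0 ∨ s = 1 := by lia
    · rw [branchColor_zero]
      exact hx.mul_eq_zero_of_add (by simp) hJ
    · rw [branchColor_one]
      rw [add_comm] at hJ
      exact hx.mul_eq_zero_of_add (by simp) hJ
  · intro h
    funext J
    rw [branchMap_apply, ← branchColor_zero, ← branchColor_one, h, h, add_zero, Pi.zero_apply]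

theorem mem_range_branchMap_iff {n : ℕ} (c : Fin n → Fin 3) (v : Fin n → R) :
    v ∈ Set.range (branchMap x c) ↔ ∀ J, x (c J) * v J = 0 := by
  constructor
  · rintro ⟨w, rfl⟩ J
    rw [branchMap_apply, mul_add, ← mul_assoc, ← mul_assoc, hx.mul_eq_zero _ _ (by simp),
      hx.mul_eq_zero _ _ (by simp)]
    simp
  · intro h
    choose a b hab using fun J => hx.exists_of_mul_eq_zero _ _ (h J)
    refine ⟨fun p => if (finProdFinEquiv.symm p).2 = 0 then a (finProdFinEquiv.symm p).1
        else b (finProdFinEquiv.symm p).1, funext fun J => ?_⟩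
    rw [branchMap_apply, hab J]
    simp

theorem coordRow_mem_maximalIdeal (v : Fin 3 → R) (j : Fin 1) :
    coordRow x v j ∈ IsLocalRing.maximalIdeal R := by
  rw [coordRow_apply]
  exact Ideal.sum_mem _ fun i _ => Ideal.mul_mem_right _ _ (hx.mem_maximalIdeal i)

theorem branchMap_mem_maximalIdeal {n : ℕ} (c : Fin n → Fin 3) (v : Fin (n * 2) → R)
    (J : Fin n) : branchMap x c v J ∈ IsLocalRing.maximalIdeal R := by
  rw [branchMap_apply]
  exact Ideal.add_mem _ (Ideal.mul_mem_right _ _ (hx.mem_maximalIdeal _))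
    (Ideal.mul_mem_right _ _ (hx.mem_maximalIdeal _))

theorem coordRow_exact : Function.Exact (coordRow x)
    ((IsLocalRing.maximalIdeal R).mkQ ∘ₗ LinearMap.proj (φ := fun _ : Fin 1 => R) 0) := by
  intro v
  refine (Submodule.Quotient.mk_eq_zero _).trans ((hx.mem_maximalIdeal_iff _).trans ?_)
  constructor
  · rintro ⟨a, ha⟩
    refine ⟨a, funext fun j => ?_⟩
    rw [Fin.eq_zero j, coordRow_apply]
    exact ha.symm
  · rintro ⟨a, rfl⟩
    exact ⟨a, coordRow_apply x a 0⟩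

/-- The minimal free resolution of the residue field. -/
noncomputable def residueResolution :
    MinimalFreeResolution R (R ⧸ IsLocalRing.maximalIdeal R) residueBetti where
  aug := (IsLocalRing.maximalIdeal R).mkQ ∘ₗ LinearMap.proj (φ := fun _ : Fin 1 => R) 0
  d := residueD x
  aug_surjective := (Submodule.mkQ_surjective _).comp fun r => ⟨fun _ => r, rfl⟩
  exact_aug := hx.coordRow_exact
  exact_d
    | 0 => fun v => (hx.coordRow_eq_zero_iff v).trans (hx.mem_range_branchMap_iff id v).symm
    | i + 1 => fun v => (hx.branchMap_eq_zero_iff (residueColor i) v).trans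
        (hx.mem_range_branchMap_iff (residueColor (i + 1)) v).symm
  minimal i := by
    rintro _ ⟨v, rfl⟩
    rw [Submodule.mem_ideal_smul_top_pi_iff]
    cases i with
    | zero => exact hx.coordRow_mem_maximalIdeal v
    | succ i => exact hx.branchMap_mem_maximalIdeal (residueColor i) v

end IsAxesSystem

end ResidueResolution

/-! ### Resolution of the quotient by a nonzerodivisor. -/

section HypersurfaceResolution

variable {R : Type u} [CommRing R]

theorem exact_lsmul_mkQ (t : R) : Function.Exact (LinearMap.lsmul R (Fin 1 → R) t)
    ((Ideal.span {t}).mkQ ∘ₗ LinearMap.proj (φ := fun _ : Fin 1 => R) 0) := by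
  intro v
  refine (Submodule.Quotient.mk_eq_zero _).trans (Ideal.mem_span_singleton.trans ?_)
  constructor
  · rintro ⟨a, ha⟩
    refine ⟨fun _ => a, funext fun j => ?_⟩
    rw [Fin.eq_zero j]
    exact ha.symm
  · rintro ⟨a, rfl⟩
    exact ⟨a 0, rfl⟩

theorem exact_zero_lsmul {M : Type*} [AddCommGroup M] [Module R M] {t : R}
    (ht : IsSMulRegular R t) :
    Function.Exact (0 : M →ₗ[R] (Fin 1 → R)) (LinearMap.lsmul R (Fin 1 → R) t) := by
  intro v
  constructor
  · intro h
    refine ⟨0, funext fun j => ?_⟩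
    exact (ht.right_eq_zero_of_smul (congrFun h j)).symm
  · rintro ⟨w, rfl⟩
    exact map_zero _

/-- The resolution `0 → R → R` of the quotient of `R` by a nonzerodivisor. -/
noncomputable def regularResolution [IsLocalRing R] {t : R} (ht : IsSMulRegular R t)
    (hm : t ∈ IsLocalRing.maximalIdeal R) :
    MinimalFreeResolution R (R ⧸ Ideal.span {t}) (fun i => if i ≤ 1 then 1 else 0) where
  aug := (Ideal.span {t}).mkQ ∘ₗ LinearMap.proj (φ := fun _ : Fin 1 => R) 0
  d
    | 0 => LinearMap.lsmul R (Fin 1 → R) t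
    | _ + 1 => 0
  aug_surjective := (Submodule.mkQ_surjective _).comp fun r => ⟨fun _ => r, rfl⟩
  exact_aug := exact_lsmul_mkQ t
  exact_d
    | 0 => exact_zero_lsmul ht
    | _ + 1 => fun _ => ⟨fun _ => ⟨0, funext fun j => Fin.elim0 j⟩, fun _ => rfl⟩
  minimal i := by
    rintro _ ⟨v, rfl⟩
    match i with
    | 0 => exact Submodule.smul_mem_smul hm Submodule.mem_top
    | i + 1 => exact Submodule.zero_mem _

end HypersurfaceResolution

/-! ### The power series ring modulo `(xy, yz, xz)` as an axes system. -/

section PowerSeriesAxes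

open MvPowerSeries

/-- A power series all of whose monomials involve a variable from `s` lies in the ideal generated
by the variables in `s`. -/
theorem MvPowerSeries.mem_span_X_of_coeff_eq_zero {σ k : Type*} [CommRing k] (s : Finset σ)
    (f : MvPowerSeries σ k) (hf : ∀ d : σ →₀ ℕ, (∀ i ∈ s, d i = 0) → coeff d f = 0) :
    f ∈ Ideal.span (X '' (s : Set σ) : Set (MvPowerSeries σ k)) := by
  classical
  induction s using Finset.induction_on generalizing f with
  | empty =>
    have : f = 0 := MvPowerSeries.ext fun d => by simpa using hf d
    simp [this]
  | insert a s _ ih =>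
    -- Split off the monomials containing `X a`: `g` is divisible by `X a`, and `h` falls under the
    -- induction hypothesis.
    let g : MvPowerSeries σ k := fun d => if d a = 0 then 0 else coeff d f
    let h : MvPowerSeries σ k := fun d => if d a = 0 then coeff d f else 0
    have hg : ∀ d, coeff d g = if d a = 0 then 0 else coeff d f := fun _ => rfl
    have hh : ∀ d, coeff d h = if d a = 0 then coeff d f else 0 := fun _ => rfl
    have hfgh : f = g + h := by
      ext d
      rw [map_add, hg, hh]
      split_ifs <;> simp
    rw [hfgh]
    refine Ideal.add_mem _ ?_ ?_
    · refine Ideal.mem_of_dvd _ (X_dvd_iff.2 fun m hm => ?_) (Ideal.subset_span ⟨a, by simp, rfl⟩)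
      rw [hg, if_pos hm]
    · refine Ideal.span_mono (Set.image_mono (by simp)) (ih h fun d hd => ?_)
      rw [hh]
      split_ifs with ha
      · exact hf d (by simpa [ha] using hd)
      · rfl

variable (k : Type u) [Field k]

/-- The images of the variables in `k[[x, y, z]] / (xy, yz, xz)`. -/
noncomputable def axesCoord (i : Fin 3) : BHat k :=
  Ideal.Quotient.mk (pointsIdeal k) (X i)

theorem X_mul_X_mem_pointsIdeal {i j : Fin 3} (hij : i ≠ j) :
    (X i * X j : MvPowerSeries (Fin 3) k) ∈ pointsIdeal k := by
  have h01 : (X 0 * X 1 : MvPowerSeries (Fin 3) k) ∈ pointsIdeal k :=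
    Ideal.subset_span (by simp)
  have h12 : (X 1 * X 2 : MvPowerSeries (Fin 3) k) ∈ pointsIdeal k :=
    Ideal.subset_span (by simp)
  have h02 : (X 0 * X 2 : MvPowerSeries (Fin 3) k) ∈ pointsIdeal k :=
    Ideal.subset_span (by simp)
  fin_cases i <;> fin_cases j <;> first | exact absurd rfl hij | assumption |
    (rw [mul_comm]; assumption)

theorem coeff_single_eq_zero_of_mem_pointsIdeal {f : MvPowerSeries (Fin 3) k}
    (hf : f ∈ pointsIdeal k) (i : Fin 3) (n : ℕ) : coeff (Finsupp.single i n) f = 0 := by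
  have key : ∀ p q : Fin 3, p ≠ q → ∀ g : MvPowerSeries (Fin 3) k,
      coeff (Finsupp.single i n) (g * (X p * X q)) = 0 := by
    intro p q hpq g
    by_cases hp : p = i
    · exact X_dvd_iff.1 (Dvd.intro_left (g * X p) (mul_assoc _ _ _)) _
        (Finsupp.single_eq_of_ne (by rintro rfl; exact hpq hp))
    · exact X_dvd_iff.1 (Dvd.intro_left (g * X q) (by ring)) _ (Finsupp.single_eq_of_ne hp)
  obtain ⟨a, b, c, rfl⟩ := Submodule.mem_span_triple.1 hf
  simp only [smul_eq_mul]
  rw [map_add, map_add, key 0 1 (by decide), key 1 2 (by decide), key 0 2 (by decide)]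
  simp

/-- The annihilator of a variable modulo `(xy, yz, xz)`. -/
theorem exists_of_axesCoord_mul_eq_zero (i : Fin 3) (f : MvPowerSeries (Fin 3) k)
    (hf : ∀ n, coeff (Finsupp.single i n) f = 0) :
    ∃ a b, f = X (i + 1) * a + X (i + 2) * b := by
  classical
  have h := mem_span_X_of_coeff_eq_zero {i + 1, i + 2} f fun d hd => by
    have hdi : d = Finsupp.single i (d i) := by
      ext j
      have h1 : d (i + 1) = 0 := hd _ (by simp)
      have h2 : d (i + 2) = 0 := hd _ (by simp)
      fin_cases i <;> fin_cases j <;> simp_all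
    rw [hdi]
    exact hf _
  rw [Finset.coe_pair, Set.image_pair, Ideal.mem_span_pair] at h
  obtain ⟨a, b, rfl⟩ := h
  exact ⟨a, b, by ring⟩

theorem coeff_single_eq_zero_of_X_mul {i : Fin 3} {f : MvPowerSeries (Fin 3) k}
    (hf : ∀ n, coeff (Finsupp.single i n) (X i * f) = 0) (n : ℕ) :
    coeff (Finsupp.single i n) f = 0 := by
  have h := hf (1 + n)
  rw [Finsupp.single_add, X, coeff_add_monomial_mul, one_mul] at h
  exact h

theorem isAxesSystem_axesCoord : IsAxesSystem (axesCoord k) where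
  mul_eq_zero i j hij := by
    rw [axesCoord, axesCoord, ← map_mul, Ideal.Quotient.eq_zero_iff_mem]
    exact X_mul_X_mem_pointsIdeal k hij
  mul_mul_eq_zero i w h := by
    obtain ⟨f, rfl⟩ := Ideal.Quotient.mk_surjective w
    rw [axesCoord, ← map_mul, ← map_mul, Ideal.Quotient.eq_zero_iff_mem] at h
    -- Cancelling `X i` twice shows that `f` has no pure powers of `X i`, so it lies in the ideal of
    -- the other two variables.
    obtain ⟨a, b, rfl⟩ := exists_of_axesCoord_mul_eq_zero k i f
      (coeff_single_eq_zero_of_X_mul k (coeff_single_eq_zero_of_X_mul k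
        (coeff_single_eq_zero_of_mem_pointsIdeal k h i)))
    rw [axesCoord, ← map_mul, Ideal.Quotient.eq_zero_iff_mem, mul_add, ← mul_assoc, ← mul_assoc]
    exact Ideal.add_mem _ (Ideal.mul_mem_right _ _ (X_mul_X_mem_pointsIdeal k (by simp)))
      (Ideal.mul_mem_right _ _ (X_mul_X_mem_pointsIdeal k (by simp)))
  exists_of_mul_eq_zero i w h := by
    obtain ⟨f, rfl⟩ := Ideal.Quotient.mk_surjective w
    rw [axesCoord, ← map_mul, Ideal.Quotient.eq_zero_iff_mem] at h
    obtain ⟨a, b, rfl⟩ := exists_of_axesCoord_mul_eq_zero k i f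
      (coeff_single_eq_zero_of_X_mul k (coeff_single_eq_zero_of_mem_pointsIdeal k h i))
    exact ⟨Ideal.Quotient.mk _ a, Ideal.Quotient.mk _ b, by simp [axesCoord]⟩
  mem_maximalIdeal_iff w := by
    obtain ⟨f, rfl⟩ := Ideal.Quotient.mk_surjective w
    rw [IsLocalRing.mem_maximalIdeal, mem_nonunits_iff]
    constructor
    · intro h
      have hf : constantCoeff f = 0 := by
        by_contra hne
        exact h ((isUnit_iff_constantCoeff.2 (isUnit_iff_ne_zero.2 hne)).map _)
      have := mem_span_X_of_coeff_eq_zero Finset.univ f fun d hd => by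
        obtain rfl : d = 0 := Finsupp.ext fun i => hd i (Finset.mem_univ i)
        exact hf
      rw [Finset.coe_univ, Set.image_univ, Ideal.mem_span_range_iff_exists_fun] at this
      obtain ⟨c, rfl⟩ := this
      exact ⟨fun i => Ideal.Quotient.mk _ (c i), by simp [axesCoord, mul_comm]⟩
    · rintro ⟨a, ha⟩ hu
      choose c hc using fun i => Ideal.Quotient.mk_surjective (a i)
      obtain ⟨v, hv⟩ := hu.exists_right_inv
      obtain ⟨g, rfl⟩ := Ideal.Quotient.mk_surjective v
      rw [ha] at hv
      simp only [axesCoord, ← hc, ← map_mul, ← map_sum] at hv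
      rw [← map_one (Ideal.Quotient.mk (pointsIdeal k)), Ideal.Quotient.mk_eq_mk_iff_sub_mem] at hv
      -- The exponent `single 0 0` is zero: this is the constant term, which equals `-1`.
      have h0 := coeff_single_eq_zero_of_mem_pointsIdeal k hv 0 0
      simp at h0

end PowerSeriesAxes

/-! ### The cones. -/

section BettiCone

variable (k : Type u) [Field k]

theorem rayFree_mem_finiteLengthBettiSequences :
    rayFree ∈ finiteLengthBettiSequences (BHat k) := by
  have hx := isAxesSystem_axesCoord k
  refine ⟨_, _, _, _, Module.length_ne_top_iff.1 ?_,
    ⟨regularResolution hx.isSMulRegular_sum hx.sum_mem_maximalIdeal⟩, ?_⟩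
  · rw [hx.length_quotient_sum]
    exact ENat.natCast_ne_top 3
  · funext i
    simp [rayFree]

theorem rayResidue_mem_finiteLengthBettiSequences :
    rayResidue ∈ finiteLengthBettiSequences (BHat k) := by
  have hx := isAxesSystem_axesCoord k
  refine ⟨_, _, _, _, Module.length_ne_top_iff.1 ?_, ⟨hx.residueResolution⟩, ?_⟩
  · rw [IsLocalRing.length_quotient_maximalIdeal]
    exact ENat.one_ne_top
  · funext i
    cases i <;> simp [rayResidue, residueBetti, threeMulTwoPow_eq]

/-- `inequalityCone` as a pointed cone. -/
def inequalityPointedCone : PointedCone ℚ (ℕ → ℚ) where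
  carrier := inequalityCone
  zero_mem' := by simp [inequalityCone]
  add_mem' := by
    rintro a b ⟨h1, h2, h3, h4⟩ ⟨g1, g2, g3, g4⟩
    refine ⟨?_, ?_, ?_, fun i hi => ?_⟩ <;> simp only [Pi.add_apply]
    · linarith
    · linarith
    · linarith
    · linarith [h4 i hi, g4 i hi]
  smul_mem' := by
    rintro ⟨c, hc⟩ a ⟨h1, h2, h3, h4⟩
    refine ⟨mul_nonneg hc h1, ?_, ?_, fun i hi => ?_⟩ <;>
      simp only [Pi.smul_apply, Nonneg.mk_smul, smul_eq_mul]
    · linarith [mul_le_mul_of_nonneg_left h2 hc]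
    · linear_combination c * h3
    · rw [h4 i hi]
      ring

theorem finiteLengthBettiSequences_subset_inequalityCone :
    finiteLengthBettiSequences (BHat k) ⊆ inequalityCone := by
  rintro _ ⟨M, _, _, b, hM, ⟨F⟩, rfl⟩
  obtain ⟨h1, h2, h3⟩ := F.betti_relations (isAxesSystem_axesCoord k) hM
  refine ⟨Nat.cast_nonneg _, ?_, ?_, fun i hi => ?_⟩
  · dsimp only
    exact_mod_cast h1
  · dsimp only
    exact_mod_cast h2
  obtain ⟨j, rfl⟩ := Nat.exists_eq_add_of_lt hi
  rw [show 2 + j + 1 = j + 3 by lia, show j + 3 - 1 = j + 2 by lia]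
  dsimp only
  exact_mod_cast h3 j

theorem inequalityCone_subset_hull :
    inequalityCone ⊆ (PointedCone.hull ℚ {rayFree, rayResidue} : Set (ℕ → ℚ)) := by
  rintro β ⟨h1, h2, h3, h4⟩
  -- Index 2, where the rays have entries 0 and 6, forces `β 2 / 6`; index 1 then forces the other
  -- coefficient, nonnegative by `2β₁ ≥ β₂`.
  have hβ : β = (β 1 - β 2 / 2) • rayFree + (β 2 / 6) • rayResidue := by
    have hpow : ∀ i, β (i + 2) = β 2 * 2 ^ i := by
      intro i
      induction i with
      | zero => simp
      | succ i ih =>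
        rw [h4 (i + 1 + 2) (by lia), show i + 1 + 2 - 1 = i + 2 by lia, ih]
        ring
    funext i
    match i with
    | 0 =>
      simp [rayFree, rayResidue]
      linarith
    | 1 =>
      simp [rayFree, rayResidue]
      ring
    | i + 2 =>
      simp [rayFree, rayResidue, hpow i]
      ring
  rw [hβ]
  exact add_mem
    (PointedCone.smul_mem _ (by linarith) (PointedCone.subset_hull (by simp)))
    (PointedCone.smul_mem _ (by linarith) (PointedCone.subset_hull (by simp)))

end BettiCone

theorem mainTheorem4 (k : Type u) [Field k] :
    (PointedCone.hull ℚ (finiteLengthBettiSequences (BHat k)) : Set (ℕ → ℚ)) =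
        (PointedCone.hull ℚ {rayFree, rayResidue} : Set (ℕ → ℚ)) ∧
      (PointedCone.hull ℚ (finiteLengthBettiSequences (BHat k)) : Set (ℕ → ℚ)) =
        inequalityCone := by
  have h1 : (PointedCone.hull ℚ (finiteLengthBettiSequences (BHat k)) : Set (ℕ → ℚ)) ⊆
      inequalityCone :=
    Submodule.span_le (p := inequalityPointedCone).2
      (finiteLengthBettiSequences_subset_inequalityCone k)
  have h2 : (PointedCone.hull ℚ {rayFree, rayResidue} : Set (ℕ → ℚ)) ⊆
      (PointedCone.hull ℚ (finiteLengthBettiSequences (BHat k)) : Set (ℕ → ℚ)) := by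
    refine Submodule.span_mono ?_
    rintro _ (rfl | rfl)
    · exact rayFree_mem_finiteLengthBettiSequences k
    · exact rayResidue_mem_finiteLengthBettiSequences k
  exact ⟨(h1.trans inequalityCone_subset_hull).antisymm h2,
    h1.antisymm (inequalityCone_subset_hull.trans h2)⟩
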